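/- Let $\lambda\in(0,1]$ be a fixed constant. For each $n$ let $X_n\sim\mathrm{Bi}(n,\pi)$ be a binomial random variable (the $X_n$ may live on different probability spaces), and let $\hat\pi_n=X_n/n$ be the maximum likelihood estimator of $\pi$. The sign test of the null hypothesis $H_0:\pi=1/2$ uses the statistic $S_n=2\sqrt n\,(\hat\pi_n-\tfrac12)$. Replace $\hat\pi_n$ in $S_n$ by the shrunken estimate $\pi_n^*=\lambda\,\frac{X_n}{n}+(1-\lambda)\cdot\tfrac12$ and denote the resulting statistic by $S_n^*=2\sqrt n\,(\pi_n^*-\tfrac12)$. Then, under $H_0$, $$\frac{S_n^*}{\lambda}\longrightarrow \mathrm{N}(0,1)\quad\text{in distribution as } n\to\infty .$$ -/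

import Mathlib

open MeasureTheory ProbabilityTheory Filter

noncomputable section

/-- The maximum likelihood estimate `x / n` of the success probability, from `x` successes in `n`
trials. -/
def binomialMLE (n x : ℕ) : ℝ := (x : ℝ) / (n : ℝ)

/-- The estimate of the success probability shrunken from `x / n` towards `target`, with
regularization parameter `lam`. -/
def shrunkenEstimate (lam target : ℝ) (n x : ℕ) : ℝ :=
  lam * binomialMLE n x + (1 - lam) * target

/-- The sign test statistic `2 √n (est - 1/2)` computed from an estimate `est` of the success
probability; the usual statistic takes `est = binomialMLE n x`. -/
def signStatistic (n : ℕ) (est : ℝ) : ℝ := 2 * Real.sqrt (n : ℝ) * (est - 1 / 2)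

end

/-! Shrinking towards 1/2 scales the deviation from 1/2 by `lam`, so dividing by `lam` recovers the
usual statistic `(2X - n)/√n`. In law this is a normalized sum of `n` fair signs; the CLT limit of
characteristic functions and Lévy continuity conclude. Only laws matter, so the spaces may vary. -/

lemma signStatistic_shrunkenEstimate_div {lam : ℝ} (hlam : lam ≠ 0) (n x : ℕ) :
    signStatistic n (shrunkenEstimate lam (1 / 2) n x) / lam =
      (Real.sqrt n)⁻¹ * (2 * (x : ℝ) - n) := by
  obtain rfl | hn := Nat.eq_zero_or_pos n
  · simp [signStatistic]
  have hn' : (0 : ℝ) < n := by exact_mod_cast hn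
  have hs : Real.sqrt n ≠ 0 := (Real.sqrt_pos.2 hn').ne'
  have hsq : Real.sqrt n ^ 2 = n := Real.sq_sqrt hn'.le
  unfold signStatistic shrunkenEstimate binomialMLE
  field_simp
  rw [hsq]
  ring

/-- `2 X - n` has the characteristic function of a sum of `n` independent signs. -/
lemma charFun_map_binomial_signed (n : ℕ) (p : unitInterval) (s : ℝ) :
    charFun ((binomial n p).map (fun k : ℕ ↦ 2 * (k : ℝ) - n)) s =
      charFun (bernoulliMeasure (1 : ℝ) (-1) p) s ^ n := by
  -- Binomial theorem: `k` successes give `k` factors `e^{is}` and `n - k` factors `e^{-is}`.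
  rw [charFun_apply_real, charFun_apply_real, integral_bernoulliMeasure,
    integral_map Measurable.of_discrete.aemeasurable (by fun_prop), integral_binomial, add_pow]
  have hI : Finset.Iic n = Finset.range (n + 1) := by ext; simp
  rw [hI]
  refine Finset.sum_congr rfl fun k hk ↦ ?_
  have hk : k ≤ n := Nat.lt_succ_iff.1 (Finset.mem_range.1 hk)
  simp only [Complex.real_smul, mul_pow, ← Complex.exp_nat_mul]
  have hexp : Complex.exp (s * ((2 * (k : ℝ) - n : ℝ) : ℂ) * Complex.I) =
      Complex.exp (k * (s * ((1 : ℝ) : ℂ) * Complex.I)) *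
        Complex.exp ((n - k : ℕ) * (s * ((-1 : ℝ) : ℂ) * Complex.I)) := by
    rw [← Complex.exp_add]
    push_cast [hk]
    ring_nf
  rw [hexp]
  push_cast
  ring

/-- **De Moivre–Laplace theorem** for `p = 1 / 2`, with each variable on its own space. -/
lemma tendstoInDistribution_symmetric_binomial {Ω : ℕ → Type*} {Ω' : Type*}
    [∀ n, MeasurableSpace (Ω n)] [MeasurableSpace Ω']
    {P : (n : ℕ) → Measure (Ω n)} [∀ n, IsProbabilityMeasure (P n)]
    {P' : Measure Ω'} [IsProbabilityMeasure P']
    {p : unitInterval} {X : (n : ℕ) → Ω n → ℕ}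
    (hX : ∀ n, HasLaw (X n) (binomial n p) (P n)) (hp : (p : ℝ) = 1 / 2)
    {Z : Ω' → ℝ} (hZ : HasLaw Z (gaussianReal 0 1) P') :
    TendstoInDistribution (fun (n : ℕ) ω ↦ (Real.sqrt n)⁻¹ * (2 * (X n ω : ℝ) - n)) atTop Z P P' where
  forall_aemeasurable n :=
    (Measurable.of_discrete (f := fun k : ℕ ↦ (Real.sqrt n)⁻¹ * (2 * (k : ℝ) - n))).comp_aemeasurable
      (hX n).aemeasurable
  aemeasurable_limit := hZ.aemeasurable
  tendsto := by
    refine ProbabilityMeasure.tendsto_iff_tendsto_charFun.2 fun t ↦ ?_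
    have hlaw (n : ℕ) : (P n).map (fun ω ↦ 2 * (X n ω : ℝ) - n) =
        (binomial n p).map (fun k : ℕ ↦ 2 * (k : ℝ) - n) := by
      rw [← (hX n).map_eq, AEMeasurable.map_map_of_aemeasurable
        Measurable.of_discrete.aemeasurable (hX n).aemeasurable]
      rfl
    have hmeas (n : ℕ) : AEMeasurable (fun ω ↦ 2 * (X n ω : ℝ) - n) (P n) :=
      (Measurable.of_discrete (f := fun k : ℕ ↦ 2 * (k : ℝ) - n)).comp_aemeasurable
        (hX n).aemeasurable
    -- A fair sign has mean 0 and second moment 1.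
    have hlim := tendsto_charFun_inv_sqrt_mul_pow (P := bernoulliMeasure (1 : ℝ) (-1) p) (X := id)
      aemeasurable_id (by rw [integral_bernoulliMeasure]; simp [hp]; norm_num)
      (by rw [integral_bernoulliMeasure]; simp) t
    rw! [hZ.map_eq]
    simpa [charFun_map_mul_comp (hmeas _), hlaw, charFun_map_binomial_signed,
      charFun_gaussianReal, neg_div] using hlim

theorem theorem5 {Ω : ℕ → Type*} {Ω' : Type*}
    [∀ n, MeasurableSpace (Ω n)] [MeasurableSpace Ω']
    (P : (n : ℕ) → Measure (Ω n)) [∀ n, IsProbabilityMeasure (P n)]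
    (P' : Measure Ω') [IsProbabilityMeasure P']
    (p : unitInterval) (X : (n : ℕ) → Ω n → ℕ)
    (hX : ∀ n, HasLaw (X n) (binomial n p) (P n))
    (H₀ : (p : ℝ) = 1 / 2)
    (Z : Ω' → ℝ) (hZ : HasLaw Z (gaussianReal 0 1) P')
    (lam : ℝ) (hlam_pos : 0 < lam) (hlam_le : lam ≤ 1) :
    TendstoInDistribution
      (fun n ω ↦ signStatistic n (shrunkenEstimate lam (1 / 2) n (X n ω)) / lam)
      atTop Z P P' := by
  simp only [signStatistic_shrunkenEstimate_div hlam_pos.ne']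
  exact tendstoInDistribution_symmetric_binomial hX H₀ hZ
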